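/- Let $\mu>0$ be an integer and $\Sigma=\{0,1,\dots,\mu\}$. Let $\mathcal{L}_{LA}\subseteq\Sigma^{\omega}$ be the set of all infinite words $A=A[0]A[1]\dots$ whose limit-average exists, that is, for which the averages $\frac1n\sum_{i=0}^{n-1}A[i]$ converge as $n\to\infty$ (equivalently, $\liminf_{n\to\infty}\frac1n\sum_{i<n}A[i]=\limsup_{n\to\infty}\frac1n\sum_{i<n}A[i]$). Then $\mathcal{L}_{LA}$ is neither an $\omega$-regular nor an $\omega$-context-free language. Here an $\omega$-language is $\omega$-regular if it is accepted by a nondeterministic Büchi automaton with finitely many states: a word is accepted if it has a run, starting in an initial state, along which some accepting state occurs infinitely often. It is $\omega$-context-free if it is accepted by a nondeterministic Büchi pushdown automaton with finitely many states, stack symbols and transitions. Each transition depends on the state and the topmost stack symbol, reads one letter or nothing ($\varepsilon$), changes the state, and replaces the topmost stack symbol by a finite word of stack symbols. A word $w\in\Sigma^\omega$ is accepted if there is an infinite run, starting in an initial state with only the start symbol on the stack, that reads the whole of $w$ and along which some accepting state occurs infinitely often. -/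

import Mathlib

open Filter Topology

/-! ### Büchi automata and ω-regular languages -/

/-- A (nondeterministic) Büchi automaton with input alphabet `α` and states `S`. -/
structure BuchiAutomaton (α S : Type) where
  /-- the transition relation -/
  trans : Set (S × α × S)
  /-- the initial states -/
  init : Set S
  /-- the accepting states -/
  accept : Set S

namespace BuchiAutomaton

variable {α S : Type}

/-- `ρ` is a run of `M` on the infinite word `w`. -/
def IsRun (M : BuchiAutomaton α S) (w : ℕ → α) (ρ : ℕ → S) : Prop :=
  ρ 0 ∈ M.init ∧ ∀ i, (ρ i, w i, ρ (i + 1)) ∈ M.trans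

/-- The set of infinite words having a run that visits some accepting state infinitely often. -/
def language (M : BuchiAutomaton α S) : Set (ℕ → α) :=
  {w | ∃ ρ : ℕ → S, M.IsRun w ρ ∧ ∃ q ∈ M.accept, ∃ᶠ i in atTop, ρ i = q}

end BuchiAutomaton

/-- A set of infinite words is ω-regular if a Büchi automaton with finitely many states
accepts exactly it. -/
def IsOmegaRegular {α : Type} (L : Set (ℕ → α)) : Prop :=
  ∃ (S : Type) (_ : Finite S) (M : BuchiAutomaton α S), M.language = L

/-! ### Büchi pushdown automata and ω-context-free languages -/

/-- A (nondeterministic) Büchi pushdown automaton with input alphabet `α`, states `S` and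
pushdown alphabet `Γ`. A transition `(s, Z, a, s', β)` can be taken in state `s` with `Z` on top
of the stack; it reads the letter `x` if `a = some x` and nothing if `a = none`, moves to state
`s'`, and replaces `Z` by the finite word `β`, whose first letter becomes the topmost one (so
`β = []` pops `Z`, and `β = [Y, Z]` pushes `Y`). There are finitely many transitions. -/
structure BuchiPDA (α S Γ : Type) where
  /-- the transition relation -/
  trans : Finset (S × Γ × Option α × S × List Γ)
  /-- the initial states -/
  init : Set S
  /-- the start symbol of the stack -/
  start : Γ
  /-- the accepting states -/
  accept : Set S

namespace BuchiPDA

variable {α S Γ : Type}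

/-- A configuration: the current state, the current stack (topmost symbol first), and the number
of input letters that have been read. -/
structure Config (S Γ : Type) where
  /-- the current state -/
  state : S
  /-- the current stack, topmost symbol first -/
  stack : List Γ
  /-- the number of input letters read so far -/
  pos : ℕ

/-- One step of `M` on the infinite word `w`. No step is possible from an empty stack. -/
def Step (M : BuchiPDA α S Γ) (w : ℕ → α) (c d : Config S Γ) : Prop :=
  ∃ (Z : Γ) (β rest : List Γ), c.stack = Z :: rest ∧ d.stack = β ++ rest ∧
    (((c.state, Z, none, d.state, β) ∈ M.trans ∧ d.pos = c.pos) ∨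
      ((c.state, Z, some (w c.pos), d.state, β) ∈ M.trans ∧ d.pos = c.pos + 1))

/-- `ρ` is a run of `M` on `w`: it starts in an initial state with only the start symbol on the
stack, each step follows a transition, and the whole infinite word is read. -/
def IsRun (M : BuchiPDA α S Γ) (w : ℕ → α) (ρ : ℕ → Config S Γ) : Prop :=
  ((ρ 0).state ∈ M.init ∧ (ρ 0).stack = [M.start] ∧ (ρ 0).pos = 0) ∧
    (∀ i, M.Step w (ρ i) (ρ (i + 1))) ∧
    Tendsto (fun i => (ρ i).pos) atTop atTop

/-- The set of infinite words having a run that visits some accepting state infinitely often. -/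
def language (M : BuchiPDA α S Γ) : Set (ℕ → α) :=
  {w | ∃ ρ : ℕ → Config S Γ, M.IsRun w ρ ∧ ∃ q ∈ M.accept, ∃ᶠ i in atTop, (ρ i).state = q}

end BuchiPDA

/-- A set of infinite words is ω-context-free if a Büchi pushdown automaton with finitely many
states and finitely many stack symbols accepts exactly it. -/
def IsOmegaContextFree {α : Type} (L : Set (ℕ → α)) : Prop :=
  ∃ (S Γ : Type) (_ : Finite S) (_ : Finite Γ) (M : BuchiPDA α S Γ), M.language = L

/-! ### The limit-average language -/

/-- The average `(A 0 + ⋯ + A (n - 1)) / n` of the prefix of length `n` (only `n ≥ 1` matters). -/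
noncomputable def prefixAverage {μ : ℕ} (A : ℕ → Fin (μ + 1)) (n : ℕ) : ℝ :=
  (∑ i ∈ Finset.range n, ((A i : ℕ) : ℝ)) / (n : ℝ)

/-- The limit-average of `A` exists: the averages of its prefixes converge. -/
def LimitAverageExists {μ : ℕ} (A : ℕ → Fin (μ + 1)) : Prop :=
  ∃ a : ℝ, Tendsto (prefixAverage A) atTop (𝓝 a)

/-- The limit-average exists exactly if the limit-average infimum and supremum coincide. -/
theorem limitAverageExists_iff {μ : ℕ} (A : ℕ → Fin (μ + 1)) :
    LimitAverageExists A ↔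
      liminf (prefixAverage A) atTop = limsup (prefixAverage A) atTop := by
  constructor
  · rintro ⟨a, ha⟩
    rw [ha.liminf_eq, ha.limsup_eq]
  · intro h
    have h0 : ∀ n, 0 ≤ prefixAverage A n := fun n => by
      unfold prefixAverage; positivity
    have h1 : ∀ n, prefixAverage A n ≤ μ := fun n => by
      unfold prefixAverage
      refine div_le_of_le_mul₀ (by positivity) (by positivity) ?_
      calc ∑ i ∈ Finset.range n, ((A i : ℕ) : ℝ) ≤ ∑ _i ∈ Finset.range n, (μ : ℝ) :=
            Finset.sum_le_sum fun i _ => by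
              exact_mod_cast Nat.lt_succ_iff.mp (A i).isLt
        _ = μ * n := by simp [mul_comm]
    exact ⟨_, tendsto_of_liminf_eq_limsup h rfl
      (isBoundedUnder_of ⟨_, h1⟩) (isBoundedUnder_of ⟨_, h0⟩)⟩

/-- The language of all infinite words over `{0, …, μ}` whose limit-average exists. -/
def limitAverageLanguage (μ : ℕ) : Set (ℕ → Fin (μ + 1)) :=
  {A | LimitAverageExists A}

/-! A Büchi automaton is a pushdown automaton with an idle stack, so only the context-free case
needs an argument. In an accepting run the stack infinitely often has a height that is never
undercut later, and by finiteness one pair `(q, Z)` of state and top symbol recurs at such moments.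
From there on nothing below `Z` is used: the tail can be replayed over any stack with `Z` on top in
state `q`, and left whenever `(q, Z)` returns (`exists_recurrent_of_mem_language`,
`IsPartialRun.extend`).

Two tails with the same `(q, Z)` and accepting state `f` can therefore be alternated, each followed
through `f` until the average of the whole prefix is near that tail's limit `a` or `b`. The
resulting word is accepted, so its averages converge and `a = b` (`limitAverage_eq_of_recurrent`).
But the limits `1 / (k + 1)` are infinitely many and the triples `(q, Z, f)` finitely many. -/

/-! ### Every ω-regular language is ω-context-free -/

/-- A Büchi automaton as a pushdown automaton that never changes its stack. -/
noncomputable def BuchiAutomaton.toPDA {α S : Type} [Finite α] [Finite S]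
    (M : BuchiAutomaton α S) : BuchiPDA α S Unit where
  trans := ((Set.toFinite M.trans).image
    fun t => (t.1, (), some t.2.1, t.2.2, [()])).toFinset
  init := M.init
  start := ()
  accept := M.accept

theorem BuchiAutomaton.toPDA_step_iff {α S : Type} [Finite α] [Finite S]
    (M : BuchiAutomaton α S) (w : ℕ → α) (c d : BuchiPDA.Config S Unit) (hc : c.stack = [()]) :
    M.toPDA.Step w c d ↔
      (c.state, w c.pos, d.state) ∈ M.trans ∧ d.stack = [()] ∧ d.pos = c.pos + 1 := by
  constructor
  · rintro ⟨Z, β, rest, h1, h2, h⟩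
    rw [hc] at h1
    obtain ⟨-, rfl⟩ := List.cons.inj h1
    simp only [toPDA, Set.Finite.mem_toFinset, Set.mem_image, Prod.mk.injEq] at h
    rcases h with ⟨⟨t, _, _, _, h, _⟩, _⟩ | ⟨⟨⟨a, b, c⟩, ht, ha, _, hb, hc, hβ⟩, hp⟩
    · simp at h
    · simp only [Option.some.injEq] at ha hb hc
      subst ha hb hc hβ
      exact ⟨ht, by simpa using h2, hp⟩
  · rintro ⟨ht, hs, hp⟩
    refine ⟨(), [()], [], hc, by simpa using hs, Or.inr ⟨?_, hp⟩⟩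
    simp only [toPDA, Set.Finite.mem_toFinset, Set.mem_image]
    exact ⟨_, ht, rfl⟩

theorem BuchiAutomaton.language_toPDA {α S : Type} [Finite α] [Finite S]
    (M : BuchiAutomaton α S) : M.toPDA.language = M.language := by
  ext w
  constructor
  · rintro ⟨ρ, ⟨⟨h0, hs0, hp0⟩, hstep, -⟩, q, hq, hf⟩
    have key : ∀ i, (ρ i).stack = [()] ∧ (ρ i).pos = i := by
      intro i
      induction i with
      | zero => exact ⟨hs0, hp0⟩
      | succ i ih =>
        obtain ⟨-, h1, h2⟩ := (M.toPDA_step_iff w _ _ ih.1).1 (hstep i)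
        exact ⟨h1, by rw [h2, ih.2]⟩
    refine ⟨fun i => (ρ i).state, ⟨h0, fun i => ?_⟩, q, hq, hf⟩
    have := ((M.toPDA_step_iff w _ _ (key i).1).1 (hstep i)).1
    rwa [(key i).2] at this
  · rintro ⟨ρ, ⟨h0, hstep⟩, q, hq, hf⟩
    refine ⟨fun i => ⟨ρ i, [()], i⟩, ⟨⟨h0, rfl, rfl⟩, fun i => ?_, tendsto_id⟩, q, hq, hf⟩
    exact (M.toPDA_step_iff w _ _ rfl).2 ⟨hstep i, rfl, rfl⟩

theorem IsOmegaRegular.isOmegaContextFree {α : Type} [Finite α] {L : Set (ℕ → α)}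
    (h : IsOmegaRegular L) : IsOmegaContextFree L := by
  obtain ⟨S, _, M, rfl⟩ := h
  exact ⟨S, Unit, inferInstance, inferInstance, M.toPDA, M.language_toPDA⟩

/-! ### Limits of averages -/

theorem tendsto_div_of_abs_sub_le {f g : ℕ → ℝ} {a K : ℝ} (hK : ∀ n, |f n - g n| ≤ K)
    (hg : Tendsto (fun n => g n / n) atTop (𝓝 a)) :
    Tendsto (fun n => f n / (n : ℝ)) atTop (𝓝 a) := by
  have h0 : Tendsto (fun n : ℕ => (f n - g n) / (n : ℝ)) atTop (𝓝 0) := by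
    refine squeeze_zero_norm (fun n => ?_) (tendsto_const_div_atTop_nhds_zero_nat K)
    rw [Real.norm_eq_abs, abs_div, Nat.abs_cast]
    exact div_le_div_of_nonneg_right (hK n) (Nat.cast_nonneg n)
  simpa [← add_div] using h0.add hg

/-- Splitting the sum over `D + n` letters in two ways shows that the sums differ only by two blocks
of `D` letters. -/
theorem sum_range_shift_abs_sub_le {μ D : ℕ} {A B : ℕ → Fin (μ + 1)}
    (h : ∀ i, A (D + i) = B i) (n : ℕ) :
    |∑ i ∈ Finset.range n, ((A i : ℕ) : ℝ) - ∑ i ∈ Finset.range n, ((B i : ℕ) : ℝ)| ≤ D * μ := by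
  have hA : ∀ i, ((A i : ℕ) : ℝ) ≤ μ := fun i => by exact_mod_cast Nat.lt_succ_iff.mp (A i).isLt
  have bound : ∀ k, ∑ i ∈ Finset.range D, ((A (k + i) : ℕ) : ℝ) ≤ D * μ := fun k => by
    simpa using Finset.sum_le_sum fun i (_ : i ∈ Finset.range D) => hA (k + i)
  have pos : ∀ k, 0 ≤ ∑ i ∈ Finset.range D, ((A (k + i) : ℕ) : ℝ) := fun k => by positivity
  have e1 := Finset.sum_range_add (fun i => ((A i : ℕ) : ℝ)) D n
  have e2 := Finset.sum_range_add (fun i => ((A i : ℕ) : ℝ)) n D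
  simp only [h] at e1
  rw [add_comm n D] at e2
  have b0 := bound 0
  have p0 := pos 0
  simp only [zero_add] at b0 p0
  rw [abs_le]
  constructor <;> linarith [bound n, pos n]

theorem tendsto_prefixAverage_shift_iff {μ D : ℕ} {A B : ℕ → Fin (μ + 1)}
    (h : ∀ i, A (D + i) = B i) (a : ℝ) :
    Tendsto (prefixAverage A) atTop (𝓝 a) ↔ Tendsto (prefixAverage B) atTop (𝓝 a) :=
  ⟨tendsto_div_of_abs_sub_le fun n => by
      rw [abs_sub_comm]; exact sum_range_shift_abs_sub_le h n,
    tendsto_div_of_abs_sub_le fun n => sum_range_shift_abs_sub_le h n⟩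

theorem prefixAverage_congr {μ n : ℕ} {A B : ℕ → Fin (μ + 1)} (h : ∀ i < n, A i = B i) :
    prefixAverage A n = prefixAverage B n := by
  unfold prefixAverage
  rw [Finset.sum_congr rfl fun i hi => by rw [h i (Finset.mem_range.1 hi)]]

theorem exists_tendsto_prefixAverage_inv {μ : ℕ} (hμ : 0 < μ) (k : ℕ) :
    ∃ A : ℕ → Fin (μ + 1), Tendsto (prefixAverage A) atTop (𝓝 (1 / ((k : ℝ) + 1))) := by
  -- The letter `1` at every `(k + 1)`-st position, `0` elsewhere.
  refine ⟨fun i => if (k + 1) ∣ (i + 1) then ⟨1, by omega⟩ else 0, ?_⟩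
  have hs : ∀ n, ∑ i ∈ Finset.range n, (((if (k + 1) ∣ (i + 1) then ⟨1, by omega⟩ else 0 :
      Fin (μ + 1)) : ℕ) : ℝ) = ((n / (k + 1) : ℕ) : ℝ) := by
    intro n
    induction n with
    | zero => simp
    | succ n ih =>
      rw [Finset.sum_range_succ, ih, Nat.succ_div]
      split_ifs <;> simp
  refine tendsto_div_of_abs_sub_le (g := fun n => n * (1 / ((k : ℝ) + 1))) (K := 1)
    (fun n => ?_) ?_
  · rw [hs, mul_one_div]
    have h1 : ((n / (k + 1) : ℕ) : ℝ) ≤ (n : ℝ) / ((k : ℝ) + 1) := by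
      have := Nat.cast_div_le (α := ℝ) (m := n) (n := k + 1)
      simpa using this
    have h2 : (n : ℝ) / ((k : ℝ) + 1) ≤ ((n / (k + 1) : ℕ) : ℝ) + 1 := by
      rw [div_le_iff₀ (by positivity)]
      have := Nat.lt_div_mul_add (a := n) (b := k + 1) (by omega)
      have h3 : n ≤ (n / (k + 1) + 1) * (k + 1) := by linarith
      exact_mod_cast h3
    rw [abs_le]
    constructor <;> linarith
  · refine tendsto_const_nhds.congr' ?_
    filter_upwards [eventually_gt_atTop 0] with n hn
    field_simp

/-! ### Recurrent runs of pushdown automata -/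

/-- Diagonal limit: since `i < n (i + 1)`, the value at `i` is final from stage `i + 1` on. -/
theorem exists_limit_of_agree {β : Type} (f : ℕ → ℕ → β) (n : ℕ → ℕ) (hn : StrictMono n)
    (h : ∀ m, ∀ i < n m, f (m + 1) i = f m i) :
    ∃ g : ℕ → β, ∀ m, ∀ i < n m, g i = f m i := by
  have agree : ∀ m k, ∀ i < n m, f (m + k) i = f m i := by
    intro m k i hi
    induction k with
    | zero => rfl
    | succ k ih =>
      rw [← add_assoc, h _ _ (hi.trans_le (hn.monotone (Nat.le_add_right m k))), ih]
  refine ⟨fun i => f (i + 1) i, fun m i hi => ?_⟩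
  have hi' : i < n (i + 1) := (Nat.lt_succ_self i).trans_le (hn.id_le (i + 1))
  show f (i + 1) i = f m i
  rw [← agree (i + 1) m i hi', ← agree m (i + 1) i hi, add_comm]

theorem exists_ge_forall_ge_le (h : ℕ → ℕ) (N : ℕ) : ∃ k ≥ N, ∀ j ≥ k, h k ≤ h j := by
  have hne : (Set.Ici N).Nonempty := Set.nonempty_Ici
  exact ⟨_, Function.argminOn_mem h _ hne, fun j hj =>
    Function.argminOn_le h _ (le_trans (Function.argminOn_mem h _ hne) hj)⟩

namespace BuchiPDA

variable {α S Γ : Type} {M : BuchiPDA α S Γ}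

theorem Step.pos_le {w : ℕ → α} {c d : Config S Γ} (h : M.Step w c d) : c.pos ≤ d.pos := by
  obtain ⟨_, _, _, _, _, ⟨_, h⟩ | ⟨_, h⟩⟩ := h <;> omega

/-- A step depends on the input only at the position of the letter that it reads. -/
theorem Step.congr {w x : ℕ → α} {c d : Config S Γ} (h : M.Step w c d)
    (hwx : c.pos < d.pos → w c.pos = x c.pos) : M.Step x c d := by
  obtain ⟨Z, β, rest, h1, h2, h | ⟨h, hp⟩⟩ := h
  · exact ⟨Z, β, rest, h1, h2, Or.inl h⟩
  · exact ⟨Z, β, rest, h1, h2, Or.inr ⟨by rwa [← hwx (by omega)], hp⟩⟩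

/-- A step that does not touch the lower part `τ` of the stack can be made over any other lower
part, at a translated input position. -/
theorem Step.transport {w x : ℕ → α} {c d c' d' : Config S Γ} {σ σ' τ τ' : List Γ}
    (h : M.Step w c d) (hσ : σ ≠ []) (hc : c.stack = σ ++ τ) (hd : d.stack = σ' ++ τ)
    (hc' : c'.stack = σ ++ τ') (hd' : d'.stack = σ' ++ τ')
    (hcs : c'.state = c.state) (hds : d'.state = d.state)
    (hp : c'.pos + d.pos = d'.pos + c.pos) (hwx : w c.pos = x c'.pos) : M.Step x c' d' := by
  obtain ⟨Z, β, rest, h1, h2, h⟩ := h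
  obtain ⟨Y, s, rfl⟩ := List.exists_cons_of_ne_nil hσ
  rw [hc, List.cons_append, List.cons.injEq] at h1
  obtain ⟨rfl, rfl⟩ := h1
  rw [hd, ← List.append_assoc, List.append_cancel_right_eq] at h2
  subst h2
  refine ⟨Y, β, s ++ τ', by simpa using hc', by simpa using hd', ?_⟩
  rw [hcs, hds, ← hwx]
  rcases h with ⟨h, h'⟩ | ⟨h, h'⟩
  · exact Or.inl ⟨h, by omega⟩
  · exact Or.inr ⟨h, by omega⟩

theorem pos_le_of_steps {w : ℕ → α} {r : ℕ → Config S Γ} {n : ℕ}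
    (h : ∀ i < n, M.Step w (r i) (r (i + 1))) {i j : ℕ} (hij : i ≤ j) (hj : j ≤ n) :
    (r i).pos ≤ (r j).pos := by
  induction j, hij using Nat.le_induction with
  | base => rfl
  | succ j hij ih => exact (ih (by omega)).trans (h j (by omega)).pos_le

/-- There is an infinite run on `w` from state `q` with stack `[Z]` that infinitely often is in
state `q` with topmost symbol `Z`, and infinitely often in state `f`. -/
def Recurrent (M : BuchiPDA α S Γ) (q : S) (Z : Γ) (f : S) (w : ℕ → α) : Prop :=
  ∃ ρ : ℕ → Config S Γ, (ρ 0).state = q ∧ (ρ 0).stack = [Z] ∧ (ρ 0).pos = 0 ∧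
    (∀ i, M.Step w (ρ i) (ρ (i + 1))) ∧ Tendsto (fun i => (ρ i).pos) atTop atTop ∧
    (∃ᶠ i in atTop, (ρ i).state = q ∧ ∃ τ, (ρ i).stack = Z :: τ) ∧
    ∃ᶠ i in atTop, (ρ i).state = f

/-- The first `n` steps of `r` are a run on `x` from an initial configuration to state `q` with
topmost symbol `Z`. -/
structure IsPartialRun (M : BuchiPDA α S Γ) (q : S) (Z : Γ) (x : ℕ → α) (r : ℕ → Config S Γ)
    (n : ℕ) : Prop where
  init : (r 0).state ∈ M.init
  stack_zero : (r 0).stack = [M.start]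
  pos_zero : (r 0).pos = 0
  step : ∀ i < n, M.Step x (r i) (r (i + 1))
  state_last : (r n).state = q
  stack_last : ∃ τ, (r n).stack = Z :: τ

/-- After a configuration of minimal height the part of the stack below its topmost symbol stays
untouched. -/
theorem exists_stack_eq_append {w : ℕ → α} {ρ : ℕ → Config S Γ} {k : ℕ} {Z : Γ} {τ : List Γ}
    (hstep : ∀ i, M.Step w (ρ i) (ρ (i + 1))) (hk : (ρ k).stack = Z :: τ)
    (hmin : ∀ j ≥ k, (ρ k).stack.length ≤ (ρ j).stack.length) (j : ℕ) :
    ∃ σ, σ ≠ [] ∧ (ρ (k + j)).stack = σ ++ τ := by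
  induction j with
  | zero => exact ⟨[Z], by simp, by simpa using hk⟩
  | succ j ih =>
    obtain ⟨σ, hσ, h⟩ := ih
    obtain ⟨Y, β, rest, h1, h2, -⟩ := hstep (k + j)
    obtain ⟨Y', s, rfl⟩ := List.exists_cons_of_ne_nil hσ
    rw [h, List.cons_append, List.cons.injEq] at h1
    obtain ⟨rfl, rfl⟩ := h1
    refine ⟨β ++ s, fun h0 => ?_, by rw [← add_assoc, h2, List.append_assoc]⟩
    have := hmin (k + j + 1) (by omega)
    rw [h2, hk, ← List.append_assoc, h0] at this
    simp at this

/-- Every accepted word splits into a partial run and a recurrent run. -/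
theorem exists_recurrent_of_mem_language [Finite S] [Finite Γ] {w : ℕ → α}
    (hw : w ∈ M.language) :
    ∃ q Z, ∃ f ∈ M.accept, ∃ r n D, M.IsPartialRun q Z w r n ∧
      M.Recurrent q Z f (fun i => w (D + i)) := by
  obtain ⟨ρ, ⟨⟨h0, hs0, hp0⟩, hstep, hpos⟩, f, hf, hfreq⟩ := hw
  have hmarks : ∃ᶠ k in atTop, ∃ p : S × Γ, (ρ k).state = p.1 ∧ (∃ τ, (ρ k).stack = p.2 :: τ) ∧
      ∀ j ≥ k, (ρ k).stack.length ≤ (ρ j).stack.length := by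
    rw [frequently_atTop]
    intro N
    obtain ⟨k, hk, hmin⟩ := exists_ge_forall_ge_le (fun j => (ρ j).stack.length) N
    obtain ⟨Z, β, rest, h1, -⟩ := hstep k
    exact ⟨k, hk, ⟨(ρ k).state, Z⟩, rfl, ⟨rest, h1⟩, hmin⟩
  obtain ⟨⟨q, Z⟩, hp⟩ : ∃ p : S × Γ, ∃ᶠ k in atTop, (ρ k).state = p.1 ∧
      (∃ τ, (ρ k).stack = p.2 :: τ) ∧
      ∀ j ≥ k, (ρ k).stack.length ≤ (ρ j).stack.length := by
    by_contra hcon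
    simp only [not_exists, not_frequently] at hcon
    -- Pigeonhole: if each of the finitely many pairs occurred only finitely often, so would all of
    -- them together.
    exact hmarks ((eventually_all.2 hcon).mono fun k hk ⟨p, h⟩ => hk p h)
  obtain ⟨k, hkq, ⟨τ, hkτ⟩, hmin⟩ := hp.exists
  have hmono : ∀ j, (ρ k).pos ≤ (ρ (k + j)).pos := fun j =>
    pos_le_of_steps (n := k + j) (fun i _ => hstep i) (by omega) le_rfl
  choose σ hσ hστ using exists_stack_eq_append hstep hkτ hmin
  have htail : Tendsto (fun j => j + k) atTop atTop := tendsto_add_atTop_nat k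
  refine ⟨q, Z, f, hf, ρ, k, (ρ k).pos, ⟨h0, hs0, hp0, fun i _ => hstep i, hkq, τ, hkτ⟩,
    -- The tail of the run with the untouched stack part `τ` and the letters already read removed.
    fun j => ⟨(ρ (k + j)).state, σ j, (ρ (k + j)).pos - (ρ k).pos⟩, hkq, ?_, by simp,
    fun i => ?_, ?_, ?_, ?_⟩
  · have := hστ 0
    rw [add_zero, hkτ] at this
    exact (List.append_cancel_right (as := [Z]) (by simpa using this)).symm
  · refine (hstep (k + i)).transport (hσ i) (hστ i) (hστ (i + 1)) (τ' := [])
      (by simp) (by simp) rfl rfl ?_ ?_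
    · have h1 := hmono i
      have h2 := hmono (i + 1)
      simp only [← add_assoc] at h2 ⊢
      omega
    · have h1 := hmono i
      simp only
      congr 1
      omega
  · have := (tendsto_sub_atTop_nat (ρ k).pos).comp (hpos.comp htail)
    simpa [Function.comp_def, add_comm] using this
  · rw [frequently_atTop] at hp ⊢
    intro N
    obtain ⟨l, hl, hlq, ⟨τ', hlτ⟩, -⟩ := hp (N + k)
    obtain ⟨j, rfl⟩ := Nat.exists_eq_add_of_le (show k ≤ l by omega)
    refine ⟨j, by omega, hlq, ?_⟩
    obtain ⟨Y, s, hs⟩ := List.exists_cons_of_ne_nil (hσ j)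
    rw [hστ j, hs, List.cons_append, List.cons.injEq] at hlτ
    exact ⟨s, by simp only [hs, hlτ.1]⟩
  · rw [frequently_atTop] at hfreq ⊢
    intro N
    obtain ⟨l, hl, hlq⟩ := hfreq (N + k)
    obtain ⟨j, rfl⟩ := Nat.exists_eq_add_of_le (show k ≤ l by omega)
    exact ⟨j, by omega, hlq⟩

/-- A partial run can be prolonged along a recurrent run until a given property, which holds
eventually for the prefixes of the new word, holds. -/
theorem IsPartialRun.extend {q f : S} {Z : Γ} {x y : ℕ → α} {r : ℕ → Config S Γ} {n : ℕ}
    (h : M.IsPartialRun q Z x r n) (hy : M.Recurrent q Z f y) :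
    ∃ x' : ℕ → α, (∀ i < (r n).pos, x' i = x i) ∧ (∀ i, x' ((r n).pos + i) = y i) ∧
      ∀ P : ℕ → Prop, (∀ᶠ m in atTop, P m) → ∃ r' n', n < n' ∧ M.IsPartialRun q Z x' r' n' ∧
        (∀ i < n + 1, r' i = r i) ∧ (r n).pos < (r' n').pos ∧
        (∃ i, n ≤ i ∧ i ≤ n' ∧ (r' i).state = f) ∧ P (r' n').pos := by
  obtain ⟨ρ, hq0, hZ0, hp0, hstep, hpos, hrec, hf⟩ := hy
  obtain ⟨τ, hτ⟩ := h.stack_last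
  refine ⟨fun i => if i < (r n).pos then x i else y (i - (r n).pos),
    fun i hi => if_pos hi, fun i => by simp, fun P hP => ?_⟩
  obtain ⟨k, hk⟩ := hf.exists
  have hpos' : Tendsto (fun i => (r n).pos + (ρ i).pos) atTop atTop :=
    tendsto_atTop_mono (fun i => Nat.le_add_left _ _) hpos
  -- A return to `(q, Z)` late enough to come after a visit to `f`, to have read a letter, and to
  -- satisfy `P`.
  obtain ⟨l, ⟨hlq, σ, hlσ⟩, hl0, hlk, hlpos, hlP⟩ := (hrec.and_eventually
    ((eventually_gt_atTop 0).and ((eventually_ge_atTop k).and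
      ((hpos.eventually_gt_atTop 0).and (hpos'.eventually hP))))).exists
  -- The old run, then `ρ` replayed on top of `τ`; both descriptions agree at index `n`.
  let r' : ℕ → Config S Γ := fun i => if i < n + 1 then r i else
    ⟨(ρ (i - n)).state, (ρ (i - n)).stack ++ τ, (r n).pos + (ρ (i - n)).pos⟩
  have hr'lt : ∀ i < n + 1, r' i = r i := fun i hi => if_pos hi
  have hr'ge : ∀ j, r' (n + j) =
      ⟨(ρ j).state, (ρ j).stack ++ τ, (r n).pos + (ρ j).pos⟩ := by
    intro j
    rcases Nat.eq_zero_or_pos j with rfl | hj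
    · have h1 := h.state_last
      rw [add_zero, hr'lt n (by omega), hq0, hZ0, hp0]
      rcases hrn : r n with ⟨s, st, p⟩
      rw [hrn] at h1 hτ
      simp only at h1 hτ
      simp [h1, hτ]
    · have : ¬ n + j < n + 1 := by omega
      simp only [r', if_neg this, Nat.add_sub_cancel_left]
  refine ⟨r', n + l, by omega, ⟨?_, ?_, ?_, fun i hi => ?_, ?_, ?_⟩, hr'lt, ?_,
    ⟨n + k, by omega, by omega, ?_⟩, ?_⟩
  · rw [hr'lt 0 (by omega)]; exact h.init
  · rw [hr'lt 0 (by omega)]; exact h.stack_zero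
  · rw [hr'lt 0 (by omega)]; exact h.pos_zero
  · rcases lt_or_ge i n with hin | hin
    · rw [hr'lt i (by omega), hr'lt (i + 1) (by omega)]
      -- A letter read during the old run lies before `(r n).pos`, where the new word agrees with
      -- `x`.
      refine (h.step i hin).congr fun hlt => (if_pos ?_).symm
      exact hlt.trans_le (pos_le_of_steps h.step (by omega) le_rfl)
    · obtain ⟨j, rfl⟩ := Nat.exists_eq_add_of_le hin
      rw [add_assoc, hr'ge, hr'ge]
      obtain ⟨Y, β, rest, h1, -⟩ := hstep j
      refine (hstep j).transport (τ := []) (σ := (ρ j).stack) (σ' := (ρ (j + 1)).stack)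
        (by rw [h1]; simp) (by simp) (by simp) rfl rfl rfl rfl ?_ (by simp)
      simp only
      omega
  · rw [hr'ge]; exact hlq
  · rw [hr'ge]; exact ⟨σ ++ τ, by simp [hlσ]⟩
  · rw [hr'ge]; simpa using hlpos
  · rw [hr'ge]; exact hk
  · rw [hr'ge]; exact hlP

/-- Partial runs that prolong each other and keep visiting an accepting state converge to an
accepting run. -/
theorem exists_mem_language_of_partialRuns {q f : S} {Z : Γ} (hf : f ∈ M.accept)
    {x : ℕ → ℕ → α} {r : ℕ → ℕ → Config S Γ} {n : ℕ → ℕ}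
    (hrun : ∀ m, M.IsPartialRun q Z (x m) (r m) (n m)) (hn : ∀ m, n m < n (m + 1))
    (hx : ∀ m, ∀ i < (r m (n m)).pos, x (m + 1) i = x m i)
    (hr : ∀ m, ∀ i < n m + 1, r (m + 1) i = r m i)
    (hpos : ∀ m, (r m (n m)).pos < (r (m + 1) (n (m + 1))).pos)
    (hvisit : ∀ m, ∃ i, n m ≤ i ∧ i ≤ n (m + 1) ∧ (r (m + 1) i).state = f) :
    ∃ w ∈ M.language, ∀ m, ∀ i < (r m (n m)).pos, w i = x m i := by
  have hn' : StrictMono n := strictMono_nat_of_lt_succ hn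
  have hpos' : StrictMono fun m => (r m (n m)).pos := strictMono_nat_of_lt_succ hpos
  obtain ⟨w, hw⟩ := exists_limit_of_agree x _ hpos' hx
  obtain ⟨ρ, hρ⟩ := exists_limit_of_agree r (fun m => n m + 1) (hn'.add_const 1) hr
  have hstep : ∀ i, M.Step w (ρ i) (ρ (i + 1)) := by
    intro i
    have hi : i < n (i + 1) := (Nat.lt_succ_self i).trans_le (hn'.id_le (i + 1))
    rw [hρ (i + 1) i (by omega), hρ (i + 1) (i + 1) (by omega)]
    refine ((hrun (i + 1)).step i hi).congr fun hlt => (hw (i + 1) _ ?_).symm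
    exact hlt.trans_le (pos_le_of_steps (hrun (i + 1)).step (by omega) le_rfl)
  refine ⟨w, ⟨ρ, ⟨?_, hstep, ?_⟩, f, hf, ?_⟩, hw⟩
  · rw [hρ 0 0 (by omega)]
    exact ⟨(hrun 0).init, (hrun 0).stack_zero, (hrun 0).pos_zero⟩
  · refine tendsto_atTop_atTop_of_monotone
      (monotone_nat_of_le_succ fun i => (hstep i).pos_le) fun b => ⟨n b, ?_⟩
    rw [hρ b (n b) (by omega)]
    exact hpos'.id_le b
  · rw [frequently_atTop]
    intro N
    obtain ⟨i, h1, h2, h3⟩ := hvisit N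
    exact ⟨i, (hn'.id_le N).trans h1, by rw [hρ (N + 1) i (by omega)]; exact h3⟩

/-- If a pushdown automaton accepts only words whose limit-average exists, then the limit-average
of a recurrent run is determined by its state, its stack symbol and its accepting state. -/
theorem limitAverage_eq_of_recurrent {μ : ℕ} {M : BuchiPDA (Fin (μ + 1)) S Γ} {q f : S} {Z : Γ}
    (hM : M.language ⊆ limitAverageLanguage μ) (hf : f ∈ M.accept)
    {x y z : ℕ → Fin (μ + 1)} {r : ℕ → Config S Γ} {n : ℕ} (hx : M.IsPartialRun q Z x r n)
    (hy : M.Recurrent q Z f y) (hz : M.Recurrent q Z f z) {a b : ℝ}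
    (ha : Tendsto (prefixAverage y) atTop (𝓝 a)) (hb : Tendsto (prefixAverage z) atTop (𝓝 b)) :
    a = b := by
  by_contra hab
  have hε : 0 < |a - b| / 3 := by have := abs_pos.2 (sub_ne_zero.2 hab); positivity
  set ε := |a - b| / 3 with hεdef
  let c : ℕ → ℝ := fun m => if Even m then a else b
  let P : Type := {p : (ℕ → Fin (μ + 1)) × (ℕ → Config S Γ) × ℕ //
    M.IsPartialRun q Z p.1 p.2.1 p.2.2}
  have hext : ∀ (m : ℕ) (p : P), ∃ p' : P, p.1.2.2 < p'.1.2.2 ∧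
      (∀ i < (p.1.2.1 p.1.2.2).pos, p'.1.1 i = p.1.1 i) ∧
      (∀ i < p.1.2.2 + 1, p'.1.2.1 i = p.1.2.1 i) ∧
      (p.1.2.1 p.1.2.2).pos < (p'.1.2.1 p'.1.2.2).pos ∧
      (∃ i, p.1.2.2 ≤ i ∧ i ≤ p'.1.2.2 ∧ (p'.1.2.1 i).state = f) ∧
      dist (prefixAverage p'.1.1 (p'.1.2.1 p'.1.2.2).pos) (c m) < ε := by
    rintro m ⟨⟨x, r, n⟩, h⟩
    obtain ⟨v, hv, hvc⟩ : ∃ v, M.Recurrent q Z f v ∧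
        Tendsto (prefixAverage v) atTop (𝓝 (c m)) := by
      by_cases hm : Even m
      · exact ⟨y, hy, by simpa [c, hm] using ha⟩
      · exact ⟨z, hz, by simpa [c, hm] using hb⟩
    obtain ⟨x', h1, h2, h3⟩ := h.extend hv
    -- The property concerns averages of `x'` itself, so `x'` has to be fixed before the stopping
    -- point; the old prefix does not affect the limit.
    obtain ⟨r', n', hnn, hrun, hr, hp, hvis, hP⟩ := h3 _
      (((tendsto_prefixAverage_shift_iff h2 _).2 hvc).eventually (Metric.ball_mem_nhds _ hε))
    exact ⟨⟨⟨x', r', n'⟩, hrun⟩, hnn, h1, hr, hp, hvis, hP⟩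
  choose F hF1 hF2 hF3 hF4 hF5 hF6 using hext
  let s : ℕ → P := fun m => Nat.rec ⟨⟨x, r, n⟩, hx⟩ (fun m p => F m p) m
  obtain ⟨w, hw, hagree⟩ := exists_mem_language_of_partialRuns hf (x := fun m => (s m).1.1)
    (r := fun m => (s m).1.2.1) (n := fun m => (s m).1.2.2) (fun m => (s m).2)
    (fun m => hF1 m (s m)) (fun m => hF2 m (s m)) (fun m => hF3 m (s m))
    (fun m => hF4 m (s m)) (fun m => hF5 m (s m))
  obtain ⟨l, hl⟩ := hM hw
  let p : ℕ → ℕ := fun m => ((s m).1.2.1 (s m).1.2.2).pos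
  have hp : StrictMono p := strictMono_nat_of_lt_succ fun m => hF4 m (s m)
  have hclose : ∀ m, dist (prefixAverage w (p (m + 1))) (c m) < ε := by
    intro m
    rw [prefixAverage_congr (hagree (m + 1))]
    exact hF6 m (s m)
  have hlim : Tendsto (fun m => prefixAverage w (p (m + 1))) atTop (𝓝 l) :=
    hl.comp (hp.tendsto_atTop.comp (tendsto_add_atTop_nat 1))
  obtain ⟨N, hN⟩ := eventually_atTop.1
    (hlim.eventually (Metric.ball_mem_nhds l (half_pos hε)))
  have e1 := hclose (2 * N)
  have e2 := hclose (2 * N + 1)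
  have n1 := Metric.mem_ball.1 (hN (2 * N) (by omega))
  have n2 := Metric.mem_ball.1 (hN (2 * N + 1) (by omega))
  have c1 : c (2 * N) = a := if_pos (by simp)
  have c2 : c (2 * N + 1) = b := if_neg (by simp)
  rw [c1, dist_comm] at e1
  rw [c2] at e2
  rw [dist_comm] at n2
  -- The path from `a` to `b` through two consecutive averages and `l` is shorter than `ε + ε / 2 +
  -- ε / 2 + ε = |a - b|`.
  have t1 := dist_triangle4 a (prefixAverage w (p (2 * N + 1))) l
    (prefixAverage w (p (2 * N + 1 + 1)))
  have t2 := dist_triangle a (prefixAverage w (p (2 * N + 1 + 1))) b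
  rw [Real.dist_eq a b] at t2
  linarith

end BuchiPDA

theorem not_isOmegaContextFree_limitAverageLanguage {μ : ℕ} (hμ : 0 < μ) :
    ¬ IsOmegaContextFree (limitAverageLanguage μ) := by
  rintro ⟨S, Γ, _, _, M, hM⟩
  choose A hA using fun k => exists_tendsto_prefixAverage_inv hμ k
  have hmem : ∀ k, A k ∈ M.language := fun k => by rw [hM]; exact ⟨_, hA k⟩
  choose q Z f hf r n D hpart hrec using fun k =>
    BuchiPDA.exists_recurrent_of_mem_language (hmem k)
  -- Infinitely many words, but only finitely many triples.
  obtain ⟨k, l, hkl, he⟩ := Finite.exists_ne_map_eq_of_infinite fun k => (q k, Z k, f k)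
  simp only [Prod.mk.injEq] at he
  obtain ⟨hq, hZ, hf'⟩ := he
  have hl := hrec l
  rw [← hq, ← hZ, ← hf'] at hl
  have := BuchiPDA.limitAverage_eq_of_recurrent hM.le (hf k) (hpart k) (hrec k) hl
    ((tendsto_prefixAverage_shift_iff (D := D k) (fun _ => rfl) _).1 (hA k))
    ((tendsto_prefixAverage_shift_iff (D := D l) (fun _ => rfl) _).1 (hA l))
  rw [one_div, one_div, inv_inj, add_left_inj, Nat.cast_inj] at this
  exact hkl this

theorem mainTheorem9 (μ : ℕ) (hμ : 0 < μ) :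
    ¬ IsOmegaRegular (limitAverageLanguage μ) ∧
      ¬ IsOmegaContextFree (limitAverageLanguage μ) :=
  ⟨fun h => not_isOmegaContextFree_limitAverageLanguage hμ h.isOmegaContextFree,
    not_isOmegaContextFree_limitAverageLanguage hμ⟩
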